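/- A $D$-set is a set $\Omega$ with a quaternary relation $D(wx;yz)$ such that for all $v,w,x,y,z\in\Omega$: (D1) $D(wx;yz)$ implies $D(xw;yz)$ and $D(yz;wx)$; (D2) $D(wx;yz)$ implies $\neg D(wy;xz)$; (D3) $D(wx;yz)$ implies $D(vx;yz)$ or $D(wx;yv)$; (D4) if $w\neq y$ and $x\neq y$ then $D(wx;yy)$. Let $\Omega$ be a $D$-set augmented with an arbitrary family of unary predicates (for instance, a colored $D$-set), and let $T$ be its complete first-order theory in the language consisting of $D$ and these predicates. Assume that $T$ has quantifier elimination in this language. Then $T$ is distal if and only if no model of $T$ contains an infinite petaled sequence. The equivalence holds also if petaled sequences are in addition required to be indiscernible. Here sequences $(a_i)_{i\in I}$ consist of single elements of a model and are indexed by linear orders. Such a sequence is indiscernible over a set $B$ if for every formula $\varphi(x_1,\dots,x_n)$ with parameters in $B$ and all $i_1<\dots<i_n$, $j_1<\dots<j_n$ in $I$, $\varphi(a_{i_1},\dots,a_{i_n})$ holds if and only if $\varphi(a_{j_1},\dots,a_{j_n})$ does; indiscernible means indiscernible over $\emptyset$. A sequence is petaled if its elements are distinct and $D(a_ia_j;a_ka_\ell)$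 fails for all pairwise distinct $i,j,k,\ell\in I$. The theory $T$ is distal if for every model $M$ of $T$, all sequences $s_1,s_2$ in $M$ indexed by nonempty linear orders without endpoints, every $c\in M$ and every $B\subseteq M$: if $s_1+s_2$ is indiscernible over $B$ and $s_1+c+s_2$ is indiscernible over $\emptyset$, then $s_1+c+s_2$ is indiscernible over $B$. -/

import Mathlib

open scoped FirstOrder

universe u v w

namespace ColoredDSet

/-- The axioms (D1)-(D4) of a `D`-set; `D w x y z` is read `D(wx;yz)`. -/
structure IsDSet {Ω : Type w} (D : Ω → Ω → Ω → Ω → Prop) : Prop where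
  d1 : ∀ w x y z, D w x y z → D x w y z ∧ D y z w x
  d2 : ∀ w x y z, D w x y z → ¬ D w y x z
  d3 : ∀ w x y z, D w x y z → ∀ v, D v x y z ∨ D w x y v
  d4 : ∀ w x y, w ≠ y → x ≠ y → D w x y y

/-- Relation symbols: one quaternary symbol `D` and a unary symbol for each `i : ι`. -/
inductive Rel (ι : Type v) : ℕ → Type v
  | D : Rel ι 4
  | color (i : ι) : Rel ι 1

/-- The language of `D`-sets augmented with unary predicates indexed by `ι`. -/
def lang (ι : Type v) : FirstOrder.Language.{0, v} :=
  ⟨fun _ => Empty, Rel ι⟩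

/-- The interpretation of the symbol `D` in a structure. -/
def DRel (ι : Type v) {M : Type w} [(lang ι).Structure M] (a b c d : M) : Prop :=
  FirstOrder.Language.Structure.RelMap (L := lang ι) (n := 4) Rel.D ![a, b, c, d]

/-- Every formula is equivalent modulo `T` to a quantifier-free formula in the same variables. -/
def HasQE {L : FirstOrder.Language.{u, v}} (T : L.Theory) : Prop :=
  ∀ (n : ℕ) (φ : L.Formula (Fin n)),
    ∃ ψ : L.Formula (Fin n), FirstOrder.Language.BoundedFormula.IsQF ψ ∧ T ⊨ᵇ FirstOrder.Language.Formula.iff φ ψ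

/-- The sequence `(s i)`, indexed by a linear order, is (order) indiscernible over `B`: formulas
with parameters from `B` do not distinguish strictly increasing tuples of the sequence. -/
def IndiscernibleOver (L : FirstOrder.Language.{u, v}) {M : Type w} [L.Structure M] (B : Set M)
    {I : Type w} [LinearOrder I] (s : I → M) : Prop :=
  ∀ (n : ℕ) (φ : L.Formula (B ⊕ Fin n)) (i j : Fin n → I), StrictMono i → StrictMono j →
    (φ.Realize (Sum.elim (fun b : B => (b : M)) (s ∘ i)) ↔
      φ.Realize (Sum.elim (fun b : B => (b : M)) (s ∘ j)))

/-- The concatenation `s₁ + s₂`. -/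
def concat {M I J : Type w} (s₁ : I → M) (s₂ : J → M) : I ⊕ₗ J → M :=
  fun k => Sum.elim s₁ s₂ (ofLex k)

/-- Distality of a theory, in terms of indiscernible sequences of singletons `s₁ + s₂` with `s₁` and
`s₂` nonempty and without endpoints. -/
def IsDistal {L : FirstOrder.Language.{u, v}} (T : L.Theory) : Prop :=
  ∀ (M : Type w) [L.Structure M], M ⊨ T →
    ∀ (I J : Type w) [LinearOrder I] [LinearOrder J] [Nonempty I] [Nonempty J]
      [NoMinOrder I] [NoMaxOrder I] [NoMinOrder J] [NoMaxOrder J]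
      (s₁ : I → M) (s₂ : J → M) (c : M) (B : Set M),
      IndiscernibleOver L B (concat s₁ s₂) →
      IndiscernibleOver L ∅ (concat s₁ (concat (fun _ : PUnit.{w + 1} => c) s₂)) →
      IndiscernibleOver L B (concat s₁ (concat (fun _ : PUnit.{w + 1} => c) s₂))

/-- All elements of the sequence are distinct and there are no nontrivial `D`-relations (those on
four distinct elements) among them. -/
structure IsPetaled (ι : Type v) {M : Type w} [(lang ι).Structure M] {I : Type w}
    (s : I → M) : Prop where
  distinct : Function.Injective s
  no_rel : ∀ i j k l : I, i ≠ j → i ≠ k → i ≠ l → j ≠ k → j ≠ l → k ≠ l →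
    ¬ DRel ι (s i) (s j) (s k) (s l)

end ColoredDSet

/-! By quantifier elimination the type of a tuple is its atomic type: equalities, colours and
`D`-relations. Suppose $s_1+c+s_2$ is indiscernible and not constant. If it is not petaled, it is a
comb (`IndiscernibleOver.isComb`): $D(a_ia_j;a_ka_l)$ for all $i<j<k<l$. Given a tuple through $c$,
take $c'$ in $s_1$ above every entry preceding $c$. The other entries and, as $s_1+s_2$ is
indiscernible over $B$, the parameters all lie in the left or the right class of
$D(\cdot\cdot;c'c)$. Two classes cannot separate $c$ from $c'$ (`IsDSet.update_iff`), so $c'$ may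
replace $c$, and indiscernibility over $B$ passes from $s_1+s_2$ to $s_1+c+s_2$. Conversely,
pigeonhole and an ultrapower turn an infinite petaled sequence into a monochromatic one
(`exists_petaled_monochromatic`). All injective tuples from it have the same type
(`IsPetaled.realize_iff`), so with $B=\{c\}$ the formula $x=c$ defeats distality. -/

namespace ColoredDSet

open FirstOrder FirstOrder.Language Filter

/-! ### Atomic types and quantifier elimination -/

section Atomic

variable {ι : Type v} {α : Type*} {M : Type w} [(lang ι).Structure M]

/-- The interpretation of the colour symbol `i` in a structure. -/
def ColorRel (ι : Type v) {M : Type w} [(lang ι).Structure M] (i : ι) (a : M) : Prop :=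
  Structure.RelMap (L := lang ι) (n := 1) (Rel.color i) ![a]

/-- The atomic formula `D(t₀t₁;t₂t₃)`. -/
def dFormula (ι : Type v) (t : Fin 4 → α) : (lang ι).Formula α :=
  Relations.formula (L := lang ι) (n := 4) Rel.D fun k => Term.var (t k)

/-- The atomic formula saying that `a` has colour `i`. -/
def colorFormula (i : ι) (a : α) : (lang ι).Formula α :=
  Relations.formula (L := lang ι) (n := 1) (Rel.color i) fun _ => Term.var a

/-- The atomic formula `a = b`. -/
def eqFormula (ι : Type v) (a b : α) : (lang ι).Formula α :=
  Term.equal (Term.var a) (Term.var b)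

theorem relMap_D (x : Fin 4 → M) :
    Structure.RelMap (L := lang ι) (n := 4) Rel.D x ↔ DRel ι (x 0) (x 1) (x 2) (x 3) := by
  unfold DRel
  have : x = ![x 0, x 1, x 2, x 3] := by
    funext k; fin_cases k <;> rfl
  rw [← this]

theorem relMap_color (i : ι) (x : Fin 1 → M) :
    Structure.RelMap (L := lang ι) (n := 1) (Rel.color i) x ↔ ColorRel ι i (x 0) := by
  unfold ColorRel
  have : x = ![x 0] := by
    funext k; fin_cases k; rfl
  rw [← this]

theorem realize_dFormula (t : Fin 4 → α) (x : α → M) :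
    (dFormula ι t).Realize x ↔ DRel ι (x (t 0)) (x (t 1)) (x (t 2)) (x (t 3)) := by
  exact (Formula.realize_rel (L := lang ι)).trans (relMap_D fun k => x (t k))

theorem realize_colorFormula (i : ι) (a : α) (x : α → M) :
    (colorFormula i a).Realize x ↔ ColorRel ι i (x a) := by
  exact (Formula.realize_rel (L := lang ι)).trans (relMap_color i fun _ => x a)

theorem realize_eqFormula (a b : α) (x : α → M) :
    (eqFormula ι a b).Realize x ↔ x a = x b := by
  unfold eqFormula
  rw [Formula.realize_equal]
  rfl

/-- Each axiom is the universal closure of a formula, hence a sentence that elementary equivalence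
transfers. -/
theorem isDSet_of_model {Ω : Type w} [(lang ι).Structure Ω] (hD : IsDSet (DRel ι (M := Ω)))
    (hM : M ⊨ (lang ι).completeTheory Ω) : IsDSet (DRel ι (M := M)) := by
  have key : ∀ (n : ℕ) (φ : (lang ι).Formula (Fin n)),
      (∀ x : Fin n → Ω, φ.Realize x) → ∀ x : Fin n → M, φ.Realize x := by
    intro n φ h x
    have e : ∀ (N : Type w) [(lang ι).Structure N],
        N ⊨ (BoundedFormula.relabel (Sum.inr : Fin n → Empty ⊕ Fin n) φ).alls ↔
          ∀ x : Fin n → N, φ.Realize x := by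
      intro N _
      unfold Sentence.Realize
      rw [BoundedFormula.realize_alls]
      exact forall_congr' fun x => Formula.realize_relabel_sumInr φ
    exact (e M).1 ((realize_iff_of_model_completeTheory Ω M _).2 ((e Ω).2 h)) x
  constructor
  · intro a b c d h
    have := key 4 ((dFormula ι ![0, 1, 2, 3]).imp
        (dFormula ι ![1, 0, 2, 3] ⊓ dFormula ι ![2, 3, 0, 1])) (by
      intro x
      simpa [realize_dFormula] using hD.d1 (x 0) (x 1) (x 2) (x 3)) ![a, b, c, d]
    simp only [Formula.realize_imp, Formula.realize_inf, realize_dFormula] at this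
    exact this h
  · intro a b c d h
    have := key 4 ((dFormula ι ![0, 1, 2, 3]).imp (dFormula ι ![0, 2, 1, 3]).not) (by
      intro x
      simpa [realize_dFormula] using hD.d2 (x 0) (x 1) (x 2) (x 3)) ![a, b, c, d]
    simp only [Formula.realize_imp, Formula.realize_not, realize_dFormula] at this
    exact this h
  · intro a b c d h z
    have := key 5 ((dFormula ι ![0, 1, 2, 3]).imp
        (dFormula ι ![4, 1, 2, 3] ⊔ dFormula ι ![0, 1, 2, 4])) (by
      intro x
      simpa [realize_dFormula] using fun h => hD.d3 (x 0) (x 1) (x 2) (x 3) h (x 4))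
      ![a, b, c, d, z]
    simp only [Formula.realize_imp, Formula.realize_sup, realize_dFormula] at this
    exact this h
  · intro a b c h₁ h₂
    have := key 3 ((eqFormula ι 0 2).not.imp ((eqFormula ι 1 2).not.imp
        (dFormula ι ![0, 1, 2, 2]))) (by
      intro x
      simpa [realize_dFormula, realize_eqFormula] using hD.d4 (x 0) (x 1) (x 2))
      ![a, b, c]
    simp only [Formula.realize_imp, Formula.realize_not, realize_dFormula,
      realize_eqFormula] at this
    exact this h₁ h₂

/-- Two assignments satisfy the same atomic relations. -/
structure AtomicEquiv (ι : Type v) {α : Type*} {M : Type w} [(lang ι).Structure M]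
    (x y : α → M) : Prop where
  eq : ∀ a b, x a = x b ↔ y a = y b
  color : ∀ i a, ColorRel ι i (x a) ↔ ColorRel ι i (y a)
  d : ∀ a b c d, DRel ι (x a) (x b) (x c) (x d) ↔ DRel ι (y a) (y b) (y c) (y d)

theorem AtomicEquiv.comp {β : Type*} {x y : α → M} (h : AtomicEquiv ι x y) (f : β → α) :
    AtomicEquiv ι (x ∘ f) (y ∘ f) :=
  ⟨fun _ _ => h.eq _ _, fun _ _ => h.color _ _, fun _ _ _ _ => h.d _ _ _ _⟩

theorem exists_eq_var {β : Type*} (t : (lang ι).Term β) : ∃ b, t = Term.var b := by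
  cases t with
  | var b => exact ⟨b, rfl⟩
  | func f _ => exact Empty.elim f

/-- Without function symbols every term is a variable, so `AtomicEquiv` covers all atomic formulas.
-/
theorem realize_isQF_iff_of_atomicEquiv {x y : α → M} {n : ℕ} {xs ys : Fin n → M} (hxy : AtomicEquiv ι (Sum.elim x xs) (Sum.elim y ys))
    {φ : (lang ι).BoundedFormula α n} (hφ : φ.IsQF) :
    φ.Realize x xs ↔ φ.Realize y ys := by
  induction hφ with
  | falsum => rfl
  | of_isAtomic h =>
    cases h with
    | equal t₁ t₂ =>
      obtain ⟨a, rfl⟩ := exists_eq_var t₁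
      obtain ⟨b, rfl⟩ := exists_eq_var t₂
      simpa only [BoundedFormula.realize_bdEqual, Term.realize_var] using hxy.eq a b
    | rel R ts =>
      choose f hf using fun k => exists_eq_var (ts k)
      obtain rfl : ts = fun k => Term.var (f k) := funext hf
      rw [BoundedFormula.realize_rel, BoundedFormula.realize_rel]
      cases R with
      | D =>
        exact (relMap_D _).trans ((hxy.d _ _ _ _).trans
          (relMap_D fun k => Sum.elim y ys (f k)).symm)
      | color i =>
        exact (relMap_color i _).trans ((hxy.color i _).trans
          (relMap_color i fun k => Sum.elim y ys (f k)).symm)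
  | imp _ _ ih₁ ih₂ => rw [BoundedFormula.realize_imp, BoundedFormula.realize_imp, ih₁, ih₂]

/-- In a theory with quantifier elimination, atomic relations determine the type of a tuple. -/
theorem AtomicEquiv.realize_formula {T : (lang ι).Theory} (hQE : HasQE T) (hM : M ⊨ T)
    [Nonempty M] {x y : α → M} (h : AtomicEquiv ι x y) (φ : (lang ι).Formula α) :
    φ.Realize x ↔ φ.Realize y := by
  classical
  -- `HasQE` concerns variables in `Fin n` while `α` is arbitrary, so `φ` is rewritten in its
  -- finitely many free variables.
  let e := φ.freeVarFinset.equivFin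
  let ψ : (lang ι).Formula (Fin φ.freeVarFinset.card) := φ.restrictFreeVar e
  have hψ : ∀ z : α → M, φ.Realize z ↔ ψ.Realize fun k => z (e.symm k) := fun z =>
    (BoundedFormula.realize_restrictFreeVar z (by simp)).symm
  obtain ⟨θ, hθ, hT⟩ := hQE _ ψ
  have hθ' : ∀ z, ψ.Realize z ↔ θ.Realize z := fun z =>
    Formula.realize_iff.1 (hT.realize_formula M (v := z))
  rw [hψ, hψ, hθ', hθ']
  have h₁ := h.comp fun k => (e.symm k : α)
  refine realize_isQF_iff_of_atomicEquiv (n := 0) ?_ hθ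
  have h₂ := h₁.comp (fun z : _ ⊕ Fin 0 => Sum.elim id finZeroElim z)
  convert h₂ using 1 <;>
    exact funext (Sum.rec (fun _ => rfl) finZeroElim)

end Atomic

/-! ### Atomic consequences of indiscernibility -/

section Indiscernible

variable {ι : Type v} {M : Type w} [(lang ι).Structure M] {I : Type w} [LinearOrder I]
  {B : Set M} {s : I → M}

theorem IndiscernibleOver.d_iff (h : IndiscernibleOver (lang ι) B s) {n : ℕ}
    (t : Fin 4 → B ⊕ Fin n) {i j : Fin n → I} (hi : StrictMono i) (hj : StrictMono j) :
    DRel ι (Sum.elim (↑) (s ∘ i) (t 0)) (Sum.elim (↑) (s ∘ i) (t 1))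
        (Sum.elim (↑) (s ∘ i) (t 2)) (Sum.elim (↑) (s ∘ i) (t 3)) ↔
      DRel ι (Sum.elim (↑) (s ∘ j) (t 0)) (Sum.elim (↑) (s ∘ j) (t 1))
        (Sum.elim (↑) (s ∘ j) (t 2)) (Sum.elim (↑) (s ∘ j) (t 3)) := by
  simpa only [realize_dFormula] using h n (dFormula ι t) i j hi hj

theorem strictMono_vec1 (a : I) : StrictMono ![a] := Subsingleton.strictMono _

theorem strictMono_vec2 {a b : I} (h : a < b) : StrictMono ![a, b] := by
  rw [Fin.strictMono_iff_lt_succ]; simpa using h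

theorem strictMono_vec3 {a b c : I} (h : a < b) (h' : b < c) : StrictMono ![a, b, c] := by
  rw [Fin.strictMono_iff_lt_succ]; intro i; fin_cases i <;> simpa

theorem strictMono_vec4 {a b c d : I} (h : a < b) (h' : b < c) (h'' : c < d) :
    StrictMono ![a, b, c, d] := by
  rw [Fin.strictMono_iff_lt_succ]; intro i; fin_cases i <;> simpa

theorem IndiscernibleOver.color_iff (h : IndiscernibleOver (lang ι) B s) (c : ι) (i j : I) :
    ColorRel ι c (s i) ↔ ColorRel ι c (s j) := by
  simpa [realize_colorFormula] using
    h 1 (colorFormula c (Sum.inr 0)) ![i] ![j] (strictMono_vec1 i) (strictMono_vec1 j)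

theorem IndiscernibleOver.eq_param (h : IndiscernibleOver (lang ι) B s) {b : M} (hb : b ∈ B)
    (i j : I) : s i = b ↔ s j = b := by
  simpa [realize_eqFormula] using
    h 1 (eqFormula ι (Sum.inr 0) (Sum.inl ⟨b, hb⟩)) ![i] ![j] (strictMono_vec1 i)
      (strictMono_vec1 j)

theorem IndiscernibleOver.eq_iff (h : IndiscernibleOver (lang ι) B s) {i j k l : I}
    (hij : i < j) (hkl : k < l) : s i = s j ↔ s k = s l := by
  simpa [realize_eqFormula] using
    h 2 (eqFormula ι (Sum.inr 0) (Sum.inr 1)) ![i, j] ![k, l] (strictMono_vec2 hij)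
      (strictMono_vec2 hkl)

/-- An indiscernible sequence is either injective or constant. -/
theorem IndiscernibleOver.injective_or_const (h : IndiscernibleOver (lang ι) B s) :
    Function.Injective s ∨ ∀ i j, s i = s j := by
  by_cases hs : ∃ i j, i < j ∧ s i = s j
  · obtain ⟨i, j, hij, e⟩ := hs
    refine Or.inr fun k l => ?_
    rcases lt_trichotomy k l with hkl | rfl | hkl
    · exact (h.eq_iff hij hkl).1 e
    · rfl
    · exact ((h.eq_iff hij hkl).1 e).symm
  · refine Or.inl fun k l e => ?_
    by_contra hkl
    rcases lt_or_gt_of_ne hkl with hkl | hkl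
    · exact hs ⟨k, l, hkl, e⟩
    · exact hs ⟨l, k, hkl, e.symm⟩

end Indiscernible

/-! ### Calculus of the relation `D` -/

namespace IsDSet

variable {M : Type w} {D : M → M → M → M → Prop} (hD : IsDSet D)
include hD

theorem swap_left {a b c d : M} (h : D a b c d) : D b a c d := (hD.d1 _ _ _ _ h).1

theorem swap {a b c d : M} (h : D a b c d) : D c d a b := (hD.d1 _ _ _ _ h).2

theorem swap_right {a b c d : M} (h : D a b c d) : D a b d c :=
  hD.swap (hD.swap_left (hD.swap h))

theorem left_comm_iff {a b c d : M} : D a b c d ↔ D b a c d := ⟨hD.swap_left, hD.swap_left⟩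

theorem comm_iff {a b c d : M} : D a b c d ↔ D c d a b := ⟨hD.swap, hD.swap⟩

/-- If the two middle entries coincide, exchanging them as in (D2) makes the relation refute itself;
the symmetries cover the other coincidences. -/
theorem disjoint {a b c d : M} (h : D a b c d) : a ≠ c ∧ a ≠ d ∧ b ≠ c ∧ b ≠ d := by
  have key : ∀ {a b c : M}, ¬ D a b a c := fun {a b c} h =>
    hD.d2 _ _ _ _ (hD.swap_left h) (hD.swap_left h)
  refine ⟨?_, ?_, ?_, ?_⟩ <;> rintro rfl
  · exact key h
  · exact key (hD.swap_right h)
  · exact key (hD.swap_left h)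
  · exact key (hD.swap_right (hD.swap_left h))

/-- The relations on tuples with a repetition. -/
theorem iff_of_not_distinct {a b c d : M}
    (h : ¬ (a ≠ b ∧ a ≠ c ∧ a ≠ d ∧ b ≠ c ∧ b ≠ d ∧ c ≠ d)) :
    D a b c d ↔ a ≠ c ∧ a ≠ d ∧ b ≠ c ∧ b ≠ d := by
  refine ⟨hD.disjoint, fun ⟨h₁, h₂, h₃, h₄⟩ => ?_⟩
  by_cases hab : a = b
  · subst hab
    exact hD.swap (hD.d4 _ _ _ h₁.symm h₂.symm)
  · by_cases hcd : c = d
    · subst hcd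
      exact hD.d4 _ _ _ h₁ h₃
    · exact absurd ⟨hab, h₁, h₂, h₃, h₄, hcd⟩ h

/-- Either `c` and `c'` are not distinguished by `u₁,u₂,u₃`, or these lie in three different
classes of the relation `D(··;c'c)`. -/
theorem replace {c c' u₁ u₂ u₃ : M} (h : D u₁ u₂ c' c ∨ D u₁ u₃ c' c ∨ D u₂ u₃ c' c)
    (hu : D c u₁ u₂ u₃) : D c' u₁ u₂ u₃ := by
  have key : ∀ {u₁ u₂ u₃ : M}, D u₁ u₂ c' c → D c u₁ u₂ u₃ → D c' u₁ u₂ u₃ := by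
    intro u₁ u₂ u₃ h hu
    rcases hD.d3 _ _ _ _ hu c' with h' | h'
    · exact h'
    · exact absurd (hD.swap_left (hD.swap h)) (fun h'' => hD.d2 _ _ _ _ (hD.swap_right h') h'')
  rcases h with h | h | h
  · exact key h hu
  · exact hD.swap_right (key h (hD.swap_right hu))
  -- (D3) with `u₁` either puts `u₁` in the class of `u₃`, a case already settled, or gives the goal
  -- up to symmetry.
  · rcases hD.d3 _ _ _ _ h u₁ with h' | h'
    · exact hD.swap_right (key h' (hD.swap_right hu))
    · exact hD.swap h'

/-- This makes it meaningful to speak of the classes of $D(\cdot\cdot;xy)$. If it failed, (D3) would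
yield both $D(ba;cx)$ and $D(bc;ax)$, against (D2). -/
theorem trans {a b c x y : M} (h₁ : D a b x y) (h₂ : D b c x y) : D a c x y := by
  rcases hD.d3 _ _ _ _ (hD.swap_left h₁) c with h | h
  · exact hD.swap_left h
  · rcases hD.d3 _ _ _ _ h₂ a with h' | h'
    · exact h'
    · exact absurd (hD.swap_right h) (hD.d2 _ _ _ _ (hD.swap_right h'))

/-- If every other entry of a tuple is in one of two classes of the relation `D(··;c'c)`, then
replacing the entry `c` by `c'` does not change the relation `D`. -/
theorem update_iff {α : Type*} [DecidableEq α] {x : α → M} {m : α} {c' p q : M}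
    (hx : ∀ a, a ≠ m → D (x a) p c' (x m) ∨ D (x a) q c' (x m)) (a b c d : α) :
    D (x a) (x b) (x c) (x d) ↔ D (Function.update x m c' a) (Function.update x m c' b)
      (Function.update x m c' c) (Function.update x m c' d) := by
  -- Of three entries in two classes, two share a class: the hypothesis of `replace`.
  have pigeon : ∀ {a b c : α}, a ≠ m → b ≠ m → c ≠ m → D (x a) (x b) c' (x m) ∨
      D (x a) (x c) c' (x m) ∨ D (x b) (x c) c' (x m) := by
    intro a b c ha hb hc
    have t : ∀ {u v r : M}, D u r c' (x m) → D v r c' (x m) → D u v c' (x m) :=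
      fun h₁ h₂ => hD.trans h₁ (hD.swap_left h₂)
    rcases hx a ha with h₁ | h₁ <;> rcases hx b hb with h₂ | h₂ <;>
      rcases hx c hc with h₃ | h₃ <;>
      first
        | exact Or.inl (t h₁ h₂)
        | exact Or.inr (Or.inl (t h₁ h₃))
        | exact Or.inr (Or.inr (t h₂ h₃))
  have single : ∀ {a b c : α}, a ≠ m → b ≠ m → c ≠ m →
      (D (x m) (x a) (x b) (x c) ↔ D c' (x a) (x b) (x c)) := by
    intro a b c ha hb hc
    refine ⟨hD.replace (pigeon ha hb hc), hD.replace ?_⟩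
    exact (pigeon ha hb hc).imp hD.swap_right (Or.imp hD.swap_right hD.swap_right)
  have ne : ∀ a, a ≠ m → x a ≠ x m ∧ x a ≠ c' := fun a ha => by
    rcases hx a ha with h | h <;> exact ⟨(hD.disjoint h).2.1, (hD.disjoint h).1⟩
  have irr₁ : ∀ {y z w}, ¬ D z y z w := fun h => (hD.disjoint h).1 rfl
  have irr₂ : ∀ {y z w}, ¬ D y z z w := fun h => (hD.disjoint h).2.2.1 rfl
  have irr₃ : ∀ {y z w}, ¬ D z y w z := fun h => (hD.disjoint h).2.1 rfl
  have irr₄ : ∀ {y z w}, ¬ D y z w z := fun h => (hD.disjoint h).2.2.2 rfl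
  have pair : ∀ {z y w}, y ≠ z → w ≠ z → D z z y w := fun h₁ h₂ => hD.swap (hD.d4 _ _ _ h₁ h₂)
  have pair' : ∀ {z y w}, y ≠ z → w ≠ z → D y w z z := fun h₁ h₂ => hD.d4 _ _ _ h₁ h₂
  -- If `m` occurs on both sides, `D` fails before and after; if it fills one side only, `D` holds
  -- by (D4). A single occurrence is moved by symmetry to the first place.
  by_cases ha : a = m <;> by_cases hb : b = m <;> by_cases hc : c = m <;> by_cases hd : d = m <;>
    simp only [ha, hb, hc, hd, Function.update_self, Function.update_of_ne, ne_eq,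
      not_false_eq_true, irr₁, irr₂, irr₃, irr₄]
  · exact iff_of_true (pair (ne _ hc).1 (ne _ hd).1) (pair (ne _ hc).2 (ne _ hd).2)
  · exact single hb hc hd
  · rw [hD.left_comm_iff, single ha hc hd, hD.left_comm_iff]
  · exact iff_of_true (pair' (ne _ ha).1 (ne _ hb).1) (pair' (ne _ ha).2 (ne _ hb).2)
  · rw [hD.comm_iff, single hd ha hb, hD.comm_iff]
  · rw [hD.comm_iff, hD.left_comm_iff, single hc ha hb, hD.left_comm_iff, hD.comm_iff]

end IsDSet

/-! ### Non-petaled indiscernible sequences are combs -/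

section Comb

variable {ι : Type v} {M : Type w} [(lang ι).Structure M] {I : Type w} [LinearOrder I]
  {B : Set M} {s : I → M}

theorem IndiscernibleOver.d_iff_seq (h : IndiscernibleOver (lang ι) B s) (σ : Fin 4 → Fin 4)
    {i j : Fin 4 → I} (hi : StrictMono i) (hj : StrictMono j) :
    DRel ι (s (i (σ 0))) (s (i (σ 1))) (s (i (σ 2))) (s (i (σ 3))) ↔
      DRel ι (s (j (σ 0))) (s (j (σ 1))) (s (j (σ 2))) (s (j (σ 3))) :=
  h.d_iff (fun k => Sum.inr (σ k)) hi hj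

/-- The `D`-relation on the sequence is that of a comb whose leaves are in increasing order. -/
def IsComb (ι : Type v) {M : Type w} [(lang ι).Structure M] {I : Type w} [LinearOrder I]
    (s : I → M) : Prop :=
  ∀ ⦃i j k l⦄, i < j → j < k → k < l → DRel ι (s i) (s j) (s k) (s l)

/-- Four points have three pairings, and each holds for all increasing quadruples or for none. For
the crossing and the nested pairing, (D3) with a fifth point contradicts (D2); only the comb pairing
remains. -/
theorem IndiscernibleOver.isComb (hD : IsDSet (DRel ι (M := M)))
    (h : IndiscernibleOver (lang ι) B s) (hinj : Function.Injective s) [Infinite I]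
    (hs : ¬ IsPetaled ι s) : IsComb ι s := by
  obtain ⟨f, hf⟩ : ∃ f : Fin 5 → I, StrictMono f := by
    obtain ⟨t, ht⟩ := Infinite.exists_subset_card_eq I 5
    exact ⟨t.orderEmbOfFin ht, (t.orderEmbOfFin ht).strictMono⟩
  have h01 : f 0 < f 1 := hf (by decide)
  have h12 : f 1 < f 2 := hf (by decide)
  have h23 : f 2 < f 3 := hf (by decide)
  have h34 : f 3 < f 4 := hf (by decide)
  have A : ∀ {i j k l i' j' k' l'}, i < j → j < k → k < l → i' < j' → j' < k' → k' < l' →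
      DRel ι (s i) (s j) (s k) (s l) → DRel ι (s i') (s j') (s k') (s l') :=
    fun h₁ h₂ h₃ h₄ h₅ h₆ => (h.d_iff_seq ![0, 1, 2, 3] (strictMono_vec4 h₁ h₂ h₃)
      (strictMono_vec4 h₄ h₅ h₆)).1
  have no_cross : ∀ {i j k l}, i < j → j < k → k < l → ¬ DRel ι (s i) (s k) (s j) (s l) := by
    intro i j k l h₁ h₂ h₃ hd
    have C : ∀ {i' j' k' l'}, i' < j' → j' < k' → k' < l' →
        DRel ι (s i') (s k') (s j') (s l') := fun h₄ h₅ h₆ =>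
      (h.d_iff_seq ![0, 2, 1, 3] (strictMono_vec4 h₁ h₂ h₃) (strictMono_vec4 h₄ h₅ h₆)).1 hd
    rcases hD.d3 _ _ _ _ (hD.swap_right (hD.swap_left (C h01 h12 h23))) (s (f 4)) with h' | h'
    · exact hD.d2 _ _ _ _ (hD.swap_left h') (hD.swap_right (C h01 (h12.trans h23) h34))
    · exact hD.d2 _ _ _ _ (hD.swap_left h') (C (h01.trans h12) h23 h34)
  have no_nest : ∀ {i j k l}, i < j → j < k → k < l → ¬ DRel ι (s i) (s l) (s j) (s k) := by
    intro i j k l h₁ h₂ h₃ hd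
    have C : ∀ {i' j' k' l'}, i' < j' → j' < k' → k' < l' →
        DRel ι (s i') (s l') (s j') (s k') := fun h₄ h₅ h₆ =>
      (h.d_iff_seq ![0, 3, 1, 2] (strictMono_vec4 h₁ h₂ h₃) (strictMono_vec4 h₄ h₅ h₆)).1 hd
    rcases hD.d3 _ _ _ _ (C h01 h12 h23) (s (f 4)) with h' | h'
    · exact hD.d2 _ _ _ _ h'
        (hD.swap_left (hD.swap_right (C h12 h23 h34)))
    · exact hD.d2 _ _ _ _ (hD.swap_right h') (hD.swap_right <| C h01 (h12.trans h23) h34)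
  by_contra hc
  have no_comb : ∀ {i j k l}, i < j → j < k → k < l → ¬ DRel ι (s i) (s j) (s k) (s l) := by
    intro i j k l h₁ h₂ h₃ hd
    exact hc fun _ _ _ _ h₄ h₅ h₆ => A h₁ h₂ h₃ h₄ h₅ h₆ hd
  have sorted : ∀ {i j k l}, i < j → k < l → i < k → j ≠ k → j ≠ l →
      ¬ DRel ι (s i) (s j) (s k) (s l) := by
    intro i j k l hij hkl hik hjk hjl hd
    rcases lt_or_gt_of_ne hjk with hjk | hjk
    · exact no_comb hij hjk hkl hd
    · rcases lt_or_gt_of_ne hjl with hjl | hjl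
      · exact no_cross hik hjk hjl hd
      · exact no_nest hik hkl hjl hd
  have sorted' : ∀ {i j k l}, i < j → k < l → i ≠ k → i ≠ l → j ≠ k → j ≠ l →
      ¬ DRel ι (s i) (s j) (s k) (s l) := by
    intro i j k l hij hkl hik hil hjk hjl hd
    rcases lt_or_gt_of_ne hik with hik | hik
    · exact sorted hij hkl hik hjk hjl hd
    · exact sorted hkl hij hik hil.symm hjl.symm (hD.swap hd)
  refine hs ⟨hinj, fun i j k l hij hik hil hjk hjl hkl hd => ?_⟩
  rcases lt_or_gt_of_ne hij with hij | hij <;> rcases lt_or_gt_of_ne hkl with hkl | hkl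
  · exact sorted' hij hkl hik hil hjk hjl hd
  · exact sorted' hij hkl hil hik hjl hjk (hD.swap_right hd)
  · exact sorted' hij hkl hjk hjl hik hil (hD.swap_left hd)
  · exact sorted' hij hkl hjl hjk hil hik (hD.swap_left (hD.swap_right hd))

end Comb

/-! ### No indiscernible petaled sequence implies distality -/

section Distal

variable {ι : Type v} {M : Type w} [(lang ι).Structure M] {I J : Type w} [LinearOrder I]
  [LinearOrder J] {B : Set M}

/-- The order embedding of `I + J` into `I + 1 + J`. -/
def skipMiddle (I J : Type w) : I ⊕ₗ J → I ⊕ₗ (PUnit.{w + 1} ⊕ₗ J) :=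
  fun k => toLex (Sum.map id (fun j => toLex (Sum.inr j)) (ofLex k))

theorem skipMiddle_strictMono : StrictMono (skipMiddle I J) := by
  rintro (a | a) (b | b) h
  · exact Sum.Lex.inl_lt_inl_iff.2 (Sum.Lex.inl_lt_inl_iff.1 h)
  · exact Sum.Lex.inl_lt_inr _ _
  · exact absurd h Sum.Lex.not_inr_lt_inl
  · exact Sum.Lex.inr_lt_inr_iff.2 (Sum.Lex.inr_lt_inr_iff.2 (Sum.Lex.inr_lt_inr_iff.1 h))

/-- The middle point of `I + 1 + J`. -/
def middle (I J : Type w) : I ⊕ₗ (PUnit.{w + 1} ⊕ₗ J) :=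
  toLex (Sum.inr (toLex (Sum.inl PUnit.unit)))

omit [LinearOrder I] [LinearOrder J] in
theorem eq_middle_or (k : I ⊕ₗ (PUnit.{w + 1} ⊕ₗ J)) :
    k = middle I J ∨ ∃ l, k = skipMiddle I J l := by
  rcases k with k | k | k
  · exact Or.inr ⟨toLex (Sum.inl k), rfl⟩
  · exact Or.inl rfl
  · exact Or.inr ⟨toLex (Sum.inr k), rfl⟩

omit [LinearOrder I] [LinearOrder J] in
theorem concat_comp_skipMiddle (s₁ : I → M) (s₂ : J → M) (c : M) :
    concat s₁ (concat (fun _ : PUnit.{w + 1} => c) s₂) ∘ skipMiddle I J = concat s₁ s₂ := by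
  funext k
  rcases k with k | k <;> rfl

theorem skipMiddle_inl_lt_middle (i : I) : skipMiddle I J (toLex (Sum.inl i)) < middle I J :=
  Sum.Lex.inl_lt_inr _ _

theorem middle_lt_skipMiddle_inr (j : J) : middle I J < skipMiddle I J (toLex (Sum.inr j)) :=
  Sum.Lex.inr_lt_inr_iff.2 (Sum.Lex.inl_lt_inr _ _)

theorem lt_middle_iff (k : I ⊕ₗ (PUnit.{w + 1} ⊕ₗ J)) :
    k < middle I J ↔ ∃ i, k = skipMiddle I J (toLex (Sum.inl i)) := by
  refine ⟨fun h => ?_, by rintro ⟨i, rfl⟩; exact skipMiddle_inl_lt_middle i⟩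
  rcases k with k | k | k
  · exact ⟨k, rfl⟩
  · exact absurd h (lt_irrefl _)
  · exact absurd h (middle_lt_skipMiddle_inr k).not_gt

/-- A parameter lies on one of the two sides of a comb which is indiscernible over it. -/
theorem IndiscernibleOver.param_side (hD : IsDSet (DRel ι (M := M)))
    {K : Type w} [LinearOrder K] {s : K → M}
    (h : IndiscernibleOver (lang ι) B s) {i j k l : K} (hij : i < j) (hjk : j < k) (hkl : k < l)
    (hd : DRel ι (s i) (s j) (s k) (s l)) {b : M} (hb : b ∈ B) :
    (∀ ⦃i j k⦄, i < j → j < k → DRel ι b (s i) (s j) (s k)) ∨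
      (∀ ⦃i j k⦄, i < j → j < k → DRel ι (s i) (s j) (s k) b) := by
  rcases hD.d3 _ _ _ _ hd b with h' | h'
  · exact Or.inl fun i' j' k' h₁ h₂ =>
      (h.d_iff (n := 3) ![Sum.inl ⟨b, hb⟩, Sum.inr 0, Sum.inr 1, Sum.inr 2]
        (strictMono_vec3 hjk hkl) (strictMono_vec3 h₁ h₂)).1 h'
  · exact Or.inr fun i' j' k' h₁ h₂ =>
      (h.d_iff (n := 3) ![Sum.inr 0, Sum.inr 1, Sum.inr 2, Sum.inl ⟨b, hb⟩]
        (strictMono_vec3 hij hjk) (strictMono_vec3 h₁ h₂)).1 h'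

/-- Over a comb, `c` is replaced by an element of the left part of the sequence which is closer to
`c` than the other elements of a tuple. -/
theorem IsComb.realize_update {T : (lang ι).Theory} (hQE : HasQE T) (hM : M ⊨ T)
    (hD : IsDSet (DRel ι (M := M))) [Nonempty J] [NoMinOrder J]
    {s : I ⊕ₗ (PUnit.{w + 1} ⊕ₗ J) → M} (hs : IsComb ι s)
    (hinj : Function.Injective s) (hcol : ∀ i k l, ColorRel ι i (s k) ↔ ColorRel ι i (s l))
    (hB : IndiscernibleOver (lang ι) B (s ∘ skipMiddle I J)) {d i' : I} (hd : d < i') {n : ℕ}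
    {i : Fin n → I ⊕ₗ (PUnit.{w + 1} ⊕ₗ J)} (hi : Function.Injective i) {m : Fin n}
    (hm : i m = middle I J)
    (hlt : ∀ a, i a < middle I J → i a < skipMiddle I J (toLex (Sum.inl i')))
    (φ : (lang ι).Formula (B ⊕ Fin n)) :
    φ.Realize (Sum.elim (fun b : B => (b : M)) (s ∘ i)) ↔
      φ.Realize (Sum.elim (fun b : B => (b : M))
        (s ∘ Function.update i m (skipMiddle I J (toLex (Sum.inl i'))))) := by
  classical
  obtain ⟨e₂⟩ := ‹Nonempty J›
  obtain ⟨e, he⟩ := exists_lt e₂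
  set c := middle I J with hc
  let L : I → I ⊕ₗ (PUnit.{w + 1} ⊕ₗ J) := fun x => skipMiddle I J (toLex (Sum.inl x))
  let R : J → I ⊕ₗ (PUnit.{w + 1} ⊕ₗ J) := fun x => skipMiddle I J (toLex (Sum.inr x))
  have hL : ∀ x, L x < c := skipMiddle_inl_lt_middle
  have hR : ∀ x, c < R x := middle_lt_skipMiddle_inr
  have hLm : StrictMono L := fun x y h => skipMiddle_strictMono (Sum.Lex.inl_lt_inl_iff.2 h)
  have hRm : StrictMono R := fun x y h => skipMiddle_strictMono (Sum.Lex.inr_lt_inr_iff.2 h)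
  have ndisj : ∀ x y, x < y → s x ≠ s y := fun _ _ h => hinj.ne h.ne
  have seq_class : ∀ x, x ≠ c → (x < c → x < L i') →
      DRel ι (s x) (s (L d)) (s (L i')) (s c) ∨ DRel ι (s x) (s (R e₂)) (s (L i')) (s c) := by
    intro x hx hx'
    rcases lt_or_gt_of_ne hx with hx | hx
    · refine Or.inl ?_
      rcases lt_trichotomy x (L d) with h | h | h
      · exact hs h (hLm hd) (hL i')
      · subst h
        exact hD.swap (hD.d4 _ _ _ (ndisj _ _ (hLm hd)).symm (ndisj _ _ (hL d)).symm)
      · exact hD.swap_left (hs h (hx' hx) (hL i'))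
    · refine Or.inr ?_
      rcases lt_trichotomy x (R e₂) with h | h | h
      · exact hD.swap (hs (hL i') hx h)
      · subst h
        exact hD.swap (hD.d4 _ _ _ (ndisj _ _ ((hL i').trans hx)) (ndisj _ _ hx))
      · exact hD.swap_left (hD.swap (hs (hL i') (hR e₂) h))
  -- Indiscernibility over `B` does not yet include `c`, so the side of `b` is known only relative
  -- to the rest of the comb. (D3) brings in `c`, and the comb relations exclude the wrong
  -- alternative.
  have param_class : ∀ b ∈ B,
      DRel ι b (s (L d)) (s (L i')) (s c) ∨ DRel ι b (s (R e₂)) (s (L i')) (s c) := by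
    intro b hb
    rcases hB.param_side hD (i := toLex (Sum.inl d)) (j := toLex (Sum.inl i'))
      (k := toLex (Sum.inr e)) (l := toLex (Sum.inr e₂)) (Sum.Lex.inl_lt_inl_iff.2 hd)
      (Sum.Lex.inl_lt_inr _ _) (Sum.Lex.inr_lt_inr_iff.2 he)
      (hs (hLm hd) ((hL i').trans (hR e)) (hRm he)) hb with h | h
    · refine Or.inl ?_
      have h₁ : DRel ι b (s (L d)) (s (L i')) (s (R e)) :=
        h (Sum.Lex.inl_lt_inl_iff.2 hd) (Sum.Lex.inl_lt_inr _ _)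
      rcases hD.d3 _ _ _ _ h₁ (s c) with h₂ | h₂
      · exact absurd (hD.swap_left h₂) fun h₃ =>
          hD.d2 _ _ _ _ h₃ (hs (hLm hd) (hL i') (hR e))
      · exact h₂
    · refine Or.inr ?_
      have h₁ : DRel ι (s (L i')) (s (R e)) (s (R e₂)) b :=
        h (Sum.Lex.inl_lt_inr _ _) (Sum.Lex.inr_lt_inr_iff.2 he)
      rcases hD.d3 _ _ _ _ (hD.swap_left h₁) (s c) with h₂ | h₂
      · exact hD.swap_left (hD.swap (hD.swap_left h₂))
      · exact absurd (hs (hL i') (hR e) (hRm he)) fun h₃ =>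
          hD.d2 _ _ _ _ (hD.swap_right (hD.swap_left h₂)) h₃
  have : Nonempty M := ⟨s c⟩
  refine AtomicEquiv.realize_formula hQE hM ?_ φ
  set x : B ⊕ Fin n → M := Sum.elim (fun b : B => (b : M)) (s ∘ i) with hx
  have hxm : x (Sum.inr m) = s c := congrArg s hm
  have e : Sum.elim (fun b : B => (b : M)) (s ∘ Function.update i m (L i')) =
      Function.update x (Sum.inr m) (s (L i')) := by
    rw [hx, Sum.update_elim_inr, ← Function.comp_update]
  have cls : ∀ a, a ≠ Sum.inr m → DRel ι (x a) (s (L d)) (s (L i')) (x (Sum.inr m)) ∨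
      DRel ι (x a) (s (R e₂)) (s (L i')) (x (Sum.inr m)) := by
    rw [hxm]
    rintro (b | a) ha
    · exact param_class b b.2
    · exact seq_class (i a) (fun h => ha (congrArg Sum.inr (hi (h.trans hm.symm)))) (hlt a)
  have ne : ∀ a, a ≠ Sum.inr m → x a ≠ x (Sum.inr m) ∧ x a ≠ s (L i') := fun a ha => by
    rcases cls a ha with h | h <;> exact ⟨(hD.disjoint h).2.1, (hD.disjoint h).1⟩
  change AtomicEquiv ι x (Sum.elim _ (s ∘ Function.update i m (L i')))
  rw [e]
  refine ⟨fun a b => ?_, fun k a => ?_, fun a b c d => hD.update_iff cls a b c d⟩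
  · by_cases ha : a = Sum.inr m <;> by_cases hb : b = Sum.inr m
    · simp [ha, hb]
    · subst ha
      rw [Function.update_self, Function.update_of_ne hb]
      exact iff_of_false (ne b hb).1.symm (ne b hb).2.symm
    · subst hb
      rw [Function.update_self, Function.update_of_ne ha]
      exact iff_of_false (ne a ha).1 (ne a ha).2
    · rw [Function.update_of_ne ha, Function.update_of_ne hb]
  · by_cases ha : a = Sum.inr m
    · rw [ha, Function.update_self, hxm]
      exact hcol _ _ _
    · rw [Function.update_of_ne ha]

/-- If no model contains an infinite indiscernible petaled sequence, then the theory is distal. -/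
theorem isDistal_of_no_petaled {T : (lang ι).Theory} (hQE : HasQE T)
    (hD : ∀ (M : Type w) [(lang ι).Structure M], M ⊨ T → IsDSet (DRel ι (M := M)))
    (hT : ¬ ∃ (M : Type w) (_ : (lang ι).Structure M) (_ : M ⊨ T)
          (I : Type w) (_ : LinearOrder I) (_ : Infinite I) (s : I → M),
          IndiscernibleOver (lang ι) ∅ s ∧ IsPetaled ι s) : IsDistal.{0, v, w} T := by
  intro M _ hM I J _ _ _ _ _ _ _ _ s₁ s₂ c B hB h₀
  set s := concat s₁ (concat (fun _ : PUnit.{w + 1} => c) s₂) with hs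
  rw [← concat_comp_skipMiddle s₁ s₂ c, ← hs] at hB
  rcases h₀.injective_or_const with hinj | hconst
  swap
  · intro n φ i j _ _
    have : s ∘ i = s ∘ j := funext fun _ => hconst _ _
    rw [this]
  have hInf : Infinite (I ⊕ₗ (PUnit.{w + 1} ⊕ₗ J)) :=
    have : Infinite I := NoMaxOrder.infinite
    inferInstanceAs (Infinite (I ⊕ (PUnit.{w + 1} ⊕ₗ J)))
  have hcomb : IsComb ι s := h₀.isComb (hD M hM) hinj fun hp =>
    hT ⟨M, inferInstance, hM, _, inferInstance, hInf, s, h₀, hp⟩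
  have avoid : ∀ (n : ℕ) (φ : (lang ι).Formula (B ⊕ Fin n))
      (i : Fin n → I ⊕ₗ (PUnit.{w + 1} ⊕ₗ J)), StrictMono i →
      ∃ i' : Fin n → I ⊕ₗ J, StrictMono i' ∧
        (φ.Realize (Sum.elim (fun b : B => (b : M)) (s ∘ i)) ↔
          φ.Realize (Sum.elim (fun b : B => (b : M)) ((s ∘ skipMiddle I J) ∘ i'))) := by
    intro n φ i hi
    have lift : ∀ k : Fin n → I ⊕ₗ (PUnit.{w + 1} ⊕ₗ J), StrictMono k →
        (∀ a, k a ≠ middle I J) → ∃ i' : Fin n → I ⊕ₗ J, StrictMono i' ∧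
          skipMiddle I J ∘ i' = k := by
      intro k hk hkm
      choose i' hi' using fun a => (eq_middle_or (k a)).resolve_left (hkm a)
      refine ⟨i', fun a b hab => ?_, funext fun a => (hi' a).symm⟩
      rw [← skipMiddle_strictMono.lt_iff_lt, ← hi', ← hi']
      exact hk hab
    by_cases hm : ∃ m, i m = middle I J
    · obtain ⟨m, hm⟩ := hm
      -- `i'` is the index of the replacement for `c`; `d` serves only to name the left class and
      -- need not lie below the tuple.
      obtain ⟨d, i', hd, hlt⟩ : ∃ d i' : I, d < i' ∧ ∀ a, i a < middle I J →
          i a < skipMiddle I J (toLex (Sum.inl i')) := by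
        have : ∀ a, ∃ x : I, i a < middle I J → i a < skipMiddle I J (toLex (Sum.inl x)) := by
          intro a
          by_cases ha : i a < middle I J
          · obtain ⟨x, hx⟩ := (lt_middle_iff _).1 ha
            obtain ⟨y, hy⟩ := exists_gt x
            exact ⟨y, fun _ => hx ▸ skipMiddle_strictMono (Sum.Lex.inl_lt_inl_iff.2 hy)⟩
          · exact ⟨Classical.arbitrary I, fun h => absurd h ha⟩
        choose x hx using this
        obtain ⟨y, hy⟩ := (Set.finite_range x).bddAbove
        obtain ⟨d, hd⟩ := exists_lt y
        refine ⟨d, y, hd, fun a ha => (hx a ha).trans_le ?_⟩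
        exact skipMiddle_strictMono.monotone (Sum.Lex.inl_le_inl_iff.2 (hy ⟨a, rfl⟩))
      have hk : StrictMono (Function.update i m (skipMiddle I J (toLex (Sum.inl i')))) := by
        have below : ∀ a, a < m → i a < skipMiddle I J (toLex (Sum.inl i')) := fun a ha =>
          hlt a (hm ▸ hi ha)
        have above : ∀ a, m < a → skipMiddle I J (toLex (Sum.inl i')) < i a := fun a ha =>
          (skipMiddle_inl_lt_middle i').trans (hm ▸ hi ha)
        intro a b hab
        by_cases ha : a = m
        · subst ha
          rw [Function.update_self, Function.update_of_ne hab.ne']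
          exact above b hab
        · by_cases hb : b = m
          · subst hb
            rw [Function.update_self, Function.update_of_ne ha]
            exact below a hab
          · rw [Function.update_of_ne ha, Function.update_of_ne hb]
            exact hi hab
      obtain ⟨k, hk₁, hk₂⟩ := lift _ hk fun a => by
        by_cases ha : a = m
        · rw [ha, Function.update_self]
          exact (skipMiddle_inl_lt_middle i').ne
        · rw [Function.update_of_ne ha, ← hm]
          exact hi.injective.ne ha
      refine ⟨k, hk₁, ?_⟩
      rw [Function.comp_assoc, hk₂]
      exact hcomb.realize_update hQE hM (hD M hM) hinj h₀.color_iff hB hd hi.injective hm hlt φ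
    · obtain ⟨k, hk₁, hk₂⟩ := lift i hi fun a ha => hm ⟨a, ha⟩
      exact ⟨k, hk₁, by rw [Function.comp_assoc, hk₂]⟩
  intro n φ i j hi hj
  obtain ⟨i', hi', ei⟩ := avoid n φ i hi
  obtain ⟨j', hj', ej⟩ := avoid n φ j hj
  exact ei.trans ((hB n φ i' j' hi' hj').trans ej.symm)

end Distal

/-! ### Petaled sequences refute distality -/

section Petaled

variable {ι : Type v} {M : Type w} [(lang ι).Structure M]

theorem IsPetaled.comp {I J : Type w} {s : I → M} (h : IsPetaled ι s) {f : J → I}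
    (hf : Function.Injective f) : IsPetaled ι (s ∘ f) :=
  ⟨h.distinct.comp hf, fun _ _ _ _ h₁ h₂ h₃ h₄ h₅ h₆ => h.no_rel _ _ _ _ (hf.ne h₁) (hf.ne h₂)
    (hf.ne h₃) (hf.ne h₄) (hf.ne h₅) (hf.ne h₆)⟩

/-- Injective tuples of elements of a petaled set of a single colour have the same type. -/
theorem IsPetaled.realize_iff {T : (lang ι).Theory} (hQE : HasQE T) (hM : M ⊨ T)
    (hD : IsDSet (DRel ι (M := M))) {K : Type w} [Nonempty K] {s : K → M} (hs : IsPetaled ι s)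
    (hcol : ∀ i k l, ColorRel ι i (s k) ↔ ColorRel ι i (s l)) {α : Type*} {x y : α → K}
    (hx : Function.Injective x) (hy : Function.Injective y) (φ : (lang ι).Formula α) :
    φ.Realize (s ∘ x) ↔ φ.Realize (s ∘ y) := by
  have : Nonempty M := ⟨s (Classical.arbitrary K)⟩
  -- On a petaled set `D` depends only on the equality pattern of its arguments.
  have hd : ∀ {z : α → K}, Function.Injective z → ∀ a b c d,
      DRel ι ((s ∘ z) a) ((s ∘ z) b) ((s ∘ z) c) ((s ∘ z) d) ↔
        ¬ (a ≠ b ∧ a ≠ c ∧ a ≠ d ∧ b ≠ c ∧ b ≠ d ∧ c ≠ d) ∧ a ≠ c ∧ a ≠ d ∧ b ≠ c ∧ b ≠ d := by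
    intro z hz a b c d
    by_cases h : a ≠ b ∧ a ≠ c ∧ a ≠ d ∧ b ≠ c ∧ b ≠ d ∧ c ≠ d
    · have := hs.no_rel (z a) (z b) (z c) (z d) (hz.ne h.1) (hz.ne h.2.1) (hz.ne h.2.2.1)
        (hz.ne h.2.2.2.1) (hz.ne h.2.2.2.2.1) (hz.ne h.2.2.2.2.2)
      exact iff_of_false this fun h' => h'.1 h
    · have e : ∀ a b, (s ∘ z) a ≠ (s ∘ z) b ↔ a ≠ b := fun a b => (hs.distinct.comp hz).ne_iff
      rw [hD.iff_of_not_distinct (by simpa only [e] using h)]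
      simp only [e, h, not_false_eq_true, true_and]
  refine AtomicEquiv.realize_formula hQE hM ⟨fun a b => ?_, fun i a => hcol _ _ _,
    fun a b c d => (hd hx a b c d).trans (hd hy a b c d).symm⟩ φ
  exact (hs.distinct.comp hx).eq_iff.trans (hs.distinct.comp hy).eq_iff.symm

theorem IsPetaled.indiscernible {T : (lang ι).Theory} (hQE : HasQE T) (hM : M ⊨ T)
    (hD : IsDSet (DRel ι (M := M))) {K : Type w} [LinearOrder K] [Nonempty K] {s : K → M}
    (hs : IsPetaled ι s) (hcol : ∀ i k l, ColorRel ι i (s k) ↔ ColorRel ι i (s l)) :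
    IndiscernibleOver (lang ι) ∅ s := by
  intro n φ i j hi hj
  have e : ∀ i : Fin n → K, Sum.elim (fun b : (∅ : Set M) => (b : M)) (s ∘ i) =
      s ∘ Sum.elim (fun b : (∅ : Set M) => absurd b.2 (Set.notMem_empty _)) i := fun i =>
    funext (Sum.rec (fun b => absurd b.2 (Set.notMem_empty _)) fun _ => rfl)
  have inj : ∀ {i : Fin n → K}, StrictMono i → Function.Injective
      (Sum.elim (fun b : (∅ : Set M) => absurd b.2 (Set.notMem_empty _)) i) := fun hi =>
    Function.Injective.sumElim (fun b => absurd b.2 (Set.notMem_empty _)) hi.injective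
      fun b => absurd b.2 (Set.notMem_empty _)
  rw [e, e]
  exact hs.realize_iff hQE hM hD hcol (inj hi) (inj hj) φ

end Petaled

/-- A petaled sequence on a countable index set, all of whose elements have the same colours,
obtained from an infinite petaled sequence in an ultrapower. -/
theorem exists_petaled_monochromatic {ι M : Type w} [(lang ι).Structure M]
    {T : (lang ι).Theory} (hM : M ⊨ T) {I : Type w} [Infinite I] {s : I → M}
    (hs : IsPetaled ι s) (K : Type w) [Countable K] :
    ∃ (N : Type w) (_ : (lang ι).Structure N) (_ : N ⊨ T) (t : K → N), IsPetaled ι t ∧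
      ∀ i k l, ColorRel ι i (t k) ↔ ColorRel ι i (t l) := by
  classical
  have : Nonempty M := ⟨s (Classical.arbitrary I)⟩
  have mono : ∀ F : Finset ι, ∃ f : K → I, Function.Injective f ∧
      ∀ i ∈ F, ∀ k l, ColorRel ι i (s (f k)) ↔ ColorRel ι i (s (f l)) := by
    intro F
    -- Finitely many colours split the sequence into finitely many pieces, one of them infinite.
    obtain ⟨y, hy⟩ := Finite.exists_infinite_fiber
      (fun (x : I) (i : F) => ColorRel ι (i : ι) (s x))
    obtain ⟨g, hg⟩ := exists_injective_nat K
    let e := Infinite.natEmbedding ((fun (x : I) (i : F) => ColorRel ι (i : ι) (s x)) ⁻¹' {y})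
    refine ⟨fun k => e (g k), Subtype.val_injective.comp (e.injective.comp hg), ?_⟩
    intro i hi k l
    have h : ∀ k, ColorRel ι i (s (e k)) = y ⟨i, hi⟩ := fun k => congrFun (e k).2 ⟨i, hi⟩
    rw [h, h]
  choose f hf hcol using mono
  -- Since `U` refines `atTop`, each colour belongs to almost every `F`, so the ultrapower makes all
  -- colours constant at once.
  let U : Ultrafilter (Finset ι) := Ultrafilter.of atTop
  let t : K → (U : Filter (Finset ι)).Product (fun _ => M) :=
    fun k => ((fun F => s (f F k) : Finset ι → M) : (U : Filter (Finset ι)).Product fun _ => M)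
  have los : ∀ {α : Type w} (φ : (lang ι).Formula α) (x : α → K),
      φ.Realize (t ∘ x) ↔ ∀ᶠ F in (U : Filter (Finset ι)), φ.Realize fun a => s (f F (x a)) :=
    fun φ x => Ultraproduct.realize_formula_cast φ fun a F => s (f F (x a))
  refine ⟨(U : Filter (Finset ι)).Product (fun _ => M), inferInstance, ?_, t, ⟨?_, ?_⟩, ?_⟩
  · refine ⟨fun φ hφ => (Ultraproduct.sentence_realize φ).2 (Eventually.of_forall fun _ => ?_)⟩
    exact hM.realize_of_mem φ hφ
  · intro k l h
    by_contra hkl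
    have := (los (eqFormula ι k l) id).1 ((realize_eqFormula _ _ _).2 h)
    obtain ⟨F, hF⟩ := this.exists
    rw [realize_eqFormula] at hF
    exact hkl (hf F (hs.distinct hF))
  · intro i j k l h₁ h₂ h₃ h₄ h₅ h₆ h
    have := (los (dFormula ι ![i, j, k, l]) id).1 ((realize_dFormula _ _).2 h)
    obtain ⟨F, hF⟩ := this.exists
    rw [realize_dFormula] at hF
    exact (hs.comp (hf F)).no_rel i j k l h₁ h₂ h₃ h₄ h₅ h₆ hF
  · intro i k l
    have hi : ∀ᶠ F in (U : Filter (Finset ι)), i ∈ F :=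
      (Ultrafilter.of_le atTop) ((eventually_ge_atTop {i}).mono fun F hF =>
        hF (Finset.mem_singleton_self i))
    have e : ∀ k, ColorRel ι i (t k) ↔
        ∀ᶠ F in (U : Filter (Finset ι)), ColorRel ι i (s (f F k)) := fun k => by
      simpa only [realize_colorFormula, Function.comp_apply, id_eq] using los (colorFormula i k) id
    rw [e, e]
    exact eventually_congr (hi.mono fun F hF => hcol F i hF k l)

instance (α : Type u) [Preorder α] [NoMaxOrder α] : NoMaxOrder (ULift.{w} α) :=
  ⟨fun a => (exists_gt a.down).imp' ULift.up fun _ h => h⟩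

instance (α : Type u) [Preorder α] [NoMinOrder α] : NoMinOrder (ULift.{w} α) :=
  ⟨fun a => (exists_lt a.down).imp' ULift.up fun _ h => h⟩

/-- A petaled sequence of a single colour witnesses the failure of distality. -/
theorem not_isDistal_of_petaled {ι : Type v} {N : Type w} [(lang ι).Structure N]
    {T : (lang ι).Theory} (hQE : HasQE T) (hN : N ⊨ T) (hD : IsDSet (DRel ι (M := N)))
    {I J : Type w} [LinearOrder I] [LinearOrder J] [Nonempty I] [Nonempty J]
    [NoMinOrder I] [NoMaxOrder I] [NoMinOrder J] [NoMaxOrder J]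
    {t : I ⊕ₗ (PUnit.{w + 1} ⊕ₗ J) → N} (ht : IsPetaled ι t)
    (hcol : ∀ i k l, ColorRel ι i (t k) ↔ ColorRel ι i (t l)) : ¬ IsDistal.{0, v, w} T := by
  intro hT
  have : Nonempty (I ⊕ₗ (PUnit.{w + 1} ⊕ₗ J)) := ⟨middle I J⟩
  let s₁ : I → N := fun i => t (toLex (Sum.inl i))
  let s₂ : J → N := fun j => t (toLex (Sum.inr (toLex (Sum.inr j))))
  let c : N := t (middle I J)
  have e : concat s₁ (concat (fun _ : PUnit.{w + 1} => c) s₂) = t := by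
    funext k
    rcases k with k | k | k <;> rfl
  have h₁ : IndiscernibleOver (lang ι) {c} (concat s₁ s₂) := by
    rw [← concat_comp_skipMiddle s₁ s₂ c, e]
    intro n φ i j hi hj
    have e' : ∀ i : Fin n → I ⊕ₗ J,
        Sum.elim (fun b : ({c} : Set N) => (b : N)) ((t ∘ skipMiddle I J) ∘ i) =
          t ∘ Sum.elim (fun _ => middle I J) (skipMiddle I J ∘ i) := fun i =>
      funext (Sum.rec (fun b => b.2) fun _ => rfl)
    have inj : ∀ {i : Fin n → I ⊕ₗ J}, StrictMono i → Function.Injective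
        (Sum.elim (fun _ : ({c} : Set N) => middle I J) (skipMiddle I J ∘ i)) := by
      intro i hi
      refine Function.Injective.sumElim (Function.injective_of_subsingleton _)
        (skipMiddle_strictMono.injective.comp hi.injective) fun _ a h => ?_
      rcases hia : i a with k | k
      · exact (skipMiddle_inl_lt_middle (J := J) k).ne' (h.trans (congrArg _ hia))
      · exact (middle_lt_skipMiddle_inr (I := I) k).ne (h.trans (congrArg _ hia))
    rw [e', e']
    exact ht.realize_iff hQE hN hD hcol (inj hi) (inj hj) φ
  have h₂ := hT N hN I J s₁ s₂ c {c} h₁ (by rw [e]; exact ht.indiscernible hQE hN hD hcol)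
  rw [e] at h₂
  have i := Classical.arbitrary I
  -- Over `{c}`, the formula $x=c$ holds at the middle index, so it would hold at an index of `I` as
  -- well.
  exact (skipMiddle_inl_lt_middle (J := J) i).ne (ht.distinct
    ((h₂.eq_param rfl (middle I J) _).1 rfl))

end ColoredDSet

theorem mainTheorem4 {ι Ω : Type u} [(ColoredDSet.lang ι).Structure Ω]
    (hD : ColoredDSet.IsDSet (ColoredDSet.DRel ι (M := Ω)))
    (T : (ColoredDSet.lang ι).Theory) (hT : T = (ColoredDSet.lang ι).completeTheory Ω)
    (hQE : ColoredDSet.HasQE T) :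
    (ColoredDSet.IsDistal.{0, u, u} T ↔
      ¬ ∃ (M : Type u) (_ : (ColoredDSet.lang ι).Structure M) (_ : M ⊨ T)
          (I : Type u) (_ : LinearOrder I) (_ : Infinite I) (s : I → M),
          ColoredDSet.IsPetaled ι s) ∧
    (ColoredDSet.IsDistal.{0, u, u} T ↔
      ¬ ∃ (M : Type u) (_ : (ColoredDSet.lang ι).Structure M) (_ : M ⊨ T)
          (I : Type u) (_ : LinearOrder I) (_ : Infinite I) (s : I → M),
          ColoredDSet.IndiscernibleOver (ColoredDSet.lang ι) ∅ s ∧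
            ColoredDSet.IsPetaled ι s) := by
  have hDM : ∀ (M : Type u) [(ColoredDSet.lang ι).Structure M], M ⊨ T →
      ColoredDSet.IsDSet (ColoredDSet.DRel ι (M := M)) := fun M _ hM =>
    ColoredDSet.isDSet_of_model hD (hT ▸ hM)
  have h₁ : ColoredDSet.IsDistal.{0, u, u} T →
      ¬ ∃ (M : Type u) (_ : (ColoredDSet.lang ι).Structure M) (_ : M ⊨ T)
          (I : Type u) (_ : LinearOrder I) (_ : Infinite I) (s : I → M),
          ColoredDSet.IsPetaled ι s := by
    rintro hdist ⟨M, _, hM, I, _, _, s, hs⟩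
    -- Two copies of ℤ around a point: no endpoints in either half, and countable, hence embeddable
    -- in any infinite piece.
    have : Countable (ULift.{u} ℤ ⊕ₗ (PUnit.{u + 1} ⊕ₗ ULift.{u} ℤ)) :=
      inferInstanceAs (Countable (ULift.{u} ℤ ⊕ (PUnit.{u + 1} ⊕ ULift.{u} ℤ)))
    obtain ⟨N, _, hN, t, ht, hcol⟩ := ColoredDSet.exists_petaled_monochromatic hM hs
      (ULift.{u} ℤ ⊕ₗ (PUnit.{u + 1} ⊕ₗ ULift.{u} ℤ))
    exact ColoredDSet.not_isDistal_of_petaled hQE hN (hDM N hN) ht hcol hdist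
  have h₂ := ColoredDSet.isDistal_of_no_petaled.{u, u} hQE hDM
  -- Both equivalences follow from the cycle: distal, no petaled sequence, no indiscernible petaled
  -- sequence, distal.
  refine ⟨⟨h₁, fun h => h₂ ?_⟩, ⟨fun h => ?_, h₂⟩⟩
  · rintro ⟨M, _, hM, I, hlin, hI, s, -, hs⟩
    exact h ⟨M, _, hM, I, hlin, hI, s, hs⟩
  · rintro ⟨M, _, hM, I, hlin, hI, s, -, hs⟩
    exact h₁ h ⟨M, _, hM, I, hlin, hI, s, hs⟩
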